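/- Let $F$ be a finite nonempty set of symbols and let $\mathcal S\subseteq 2^F\setminus\{F\}$ be a family of scenarios such that every symbol of $F$ occurs in at least one scenario. A tile is a two-element subset of $F$, and a tileset is a finite multiset of tiles. A tileset $\mathcal T$ is feasible for a scenario $S$ if there is a map $\phi\colon\mathcal T\to F$, with $\phi(T)\in T$ for every $T\in\mathcal T$ (repeated copies of a tile may be mapped differently), such that $S\subseteq\phi[\mathcal T]$; it is feasible for $\mathcal S$ if it is feasible for every $S\in\mathcal S$. For $F'\subseteq F$ write $\bar F_i(F')$ for the family of all $i$-element subsets $C\subseteq F'$ with $C\not\subseteq S$ for all $S\in\mathcal S$. Algorithm A, on input $(F,\mathcal S)$, proceeds as follows. 1. Let $\mathcal T_2$ be a maximum (cardinality) matching in the graph with vertex set $F$ and edge set $\bar F_2(F)$. 2. Let $\mathcal P$ be a greedy set packing of $\bar F_3\bigl(F\setminus\bigcup_{t\in\mathcal T_2}t\bigr)$: starting with $\mathcal P=\emptyset$, repeatedly add to $\mathcal P$ an arbitrary member of this family that is disjoint from all members of $\mathcal P$, until no such member exists. 3. Let $\mathcal T_3=\bigcup_{\{f_1,f_2,f_3\}\in\mathcal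 P}\{\{f_1,f_2\},\{f_2,f_3\}\}$, where the symbols of each member of $\mathcal P$ are named $f_1,f_2,f_3$ arbitrarily. 4. If $\mathcal T_2\cup\mathcal T_3\neq\emptyset$, take an arbitrary $f_{\mathrm{root}}\in\bigcup_{t\in\mathcal T_2\cup\mathcal T_3}t$; otherwise take an arbitrary $f_{\mathrm{root}}\in F$. 5. Let $\mathcal T_1=\{\{f,f_{\mathrm{root}}\}\mid f\in F\setminus\bigcup_{t\in\mathcal T_2\cup\mathcal T_3}t,\ f\neq f_{\mathrm{root}}\}$, and return the set $\mathcal T=\mathcal T_1\cup\mathcal T_2\cup\mathcal T_3$. **Theorem.** Algorithm A computes a $4/3$-approximation for Minimum Feasible Tileset: the algorithm can always be carried out, and, whatever choices it makes in steps 1–4, the returned $\mathcal T$ is a tileset that is feasible for $\mathcal S$ and satisfies $|\mathcal T|\le\frac43\,|\mathcal T'|$ for every tileset $\mathcal T'$ feasible for $\mathcal S$ (with $|\mathcal T'|$ counted with multiplicity); that is, $|\mathcal T|$ is at most $4/3$ times the minimum number of tiles of a feasible tileset. -/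

import Mathlib

namespace FeasibleTileset

variable {F : Type*} [DecidableEq F]

/-- A tileset: a finite multiset of tiles, where a tile is a two-element set of symbols. -/
def IsTileset (𝒯 : Multiset (Finset F)) : Prop :=
  ∀ T ∈ 𝒯, T.card = 2

/-- `𝒯` is feasible for the scenario `S`: one can choose a symbol `φ T ∈ T` for every tile `T`
of `𝒯` (for every copy separately, if a tile is repeated) such that all symbols of `S` are
chosen. The type `𝒯.ToType` has one element for each occurrence of a tile in `𝒯`. -/
def FeasibleFor (𝒯 : Multiset (Finset F)) (S : Finset F) : Prop :=
  ∃ φ : 𝒯.ToType → F, (∀ T : 𝒯.ToType, φ T ∈ T.1) ∧ ∀ s ∈ S, ∃ T : 𝒯.ToType, φ T = s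

/-- A tileset that is feasible for every scenario in `𝒮`. -/
def IsFeasibleTileset (𝒮 : Finset (Finset F)) (𝒯 : Multiset (Finset F)) : Prop :=
  IsTileset 𝒯 ∧ ∀ S ∈ 𝒮, FeasibleFor 𝒯 S

/-- `𝒯` is a feasible tileset that has at most `ρ` times as many tiles (counted with
multiplicity) as any feasible tileset, hence at most `ρ` times the minimum possible number. -/
def IsApproximation (ρ : ℚ) (𝒮 : Finset (Finset F)) (𝒯 : Multiset (Finset F)) : Prop :=
  IsFeasibleTileset 𝒮 𝒯 ∧
    ∀ 𝒯' : Multiset (Finset F), IsFeasibleTileset 𝒮 𝒯' →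
      (Multiset.card 𝒯 : ℚ) ≤ ρ * (Multiset.card 𝒯' : ℚ)

/-- The family of the `i`-element subsets of `F'` that are contained in no scenario. -/
def allowedSets (𝒮 : Finset (Finset F)) (i : ℕ) (F' : Finset F) : Finset (Finset F) :=
  (F'.powersetCard i).filter fun C => ∀ S ∈ 𝒮, ¬ C ⊆ S

/-- The set of all symbols that lie on some member of a family of sets of symbols. -/
def support (𝒜 : Finset (Finset F)) : Finset F :=
  𝒜.biUnion id

/-- `M` is a matching in the graph whose edges are the two-element sets in `E`. -/
def IsMatching (E M : Finset (Finset F)) : Prop :=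
  M ⊆ E ∧ ∀ e ∈ M, ∀ e' ∈ M, e ≠ e' → Disjoint e e'

/-- A matching of maximum cardinality. -/
def IsMaximumMatching (E M : Finset (Finset F)) : Prop :=
  IsMatching E M ∧ ∀ M' : Finset (Finset F), IsMatching E M' → M'.card ≤ M.card

/-- The packings that the greedy procedure can reach: start with the empty packing and,
in each step, add any candidate in `𝒞` that is disjoint from all the sets taken before. -/
inductive GreedyReach (𝒞 : Finset (Finset F)) : Finset (Finset F) → Prop
  | start : GreedyReach 𝒞 ∅
  | take (P : Finset (Finset F)) (C : Finset F) :
      GreedyReach 𝒞 P → C ∈ 𝒞 → (∀ D ∈ P, Disjoint C D) → GreedyReach 𝒞 (insert C P)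

/-- The possible results of greedy set packing: a reachable packing at which the procedure
stops, because every remaining candidate meets a set taken before. -/
def IsGreedyPacking (𝒞 P : Finset (Finset F)) : Prop :=
  GreedyReach 𝒞 P ∧ ∀ C ∈ 𝒞, ∃ D ∈ P, ¬ Disjoint C D

/-- The tiles `{f₁, f₂}`, `{f₂, f₃}` of all the triples `C = {f₁, f₂, f₃}` in `P`, where
`f₁, f₂, f₃ = f C 0, f C 1, f C 2`. -/
def tripleTiles (P : Finset (Finset F)) (f : Finset F → Fin 3 → F) : Finset (Finset F) :=
  P.biUnion fun C => {{f C 0, f C 1}, {f C 1, f C 2}}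

/-- An execution of Algorithm A on the symbols `F` and the scenarios `𝒮`. The algorithm is
nondeterministic: the fields record its choices. -/
structure Execution [Fintype F] (𝒮 : Finset (Finset F)) where
  /-- a maximum matching of allowed pairs -/
  T₂ : Finset (Finset F)
  maximumMatching : IsMaximumMatching (allowedSets 𝒮 2 Finset.univ) T₂
  /-- a greedy packing of allowed triples of symbols not covered by the matching -/
  P : Finset (Finset F)
  greedyPacking : IsGreedyPacking (allowedSets 𝒮 3 (Finset.univ \ support T₂)) P
  /-- an arbitrary naming of the three symbols of each triple -/
  naming : Finset F → Fin 3 → F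
  naming_spec : ∀ C ∈ P, C = {naming C 0, naming C 1, naming C 2}
  /-- the root, taken from the tiles constructed so far whenever there are any -/
  root : F
  root_spec : T₂ ∪ tripleTiles P naming ≠ ∅ → root ∈ support (T₂ ∪ tripleTiles P naming)

namespace Execution

variable [Fintype F] {𝒮 : Finset (Finset F)}

/-- The tiles made from the packed triples. -/
def T₃ (A : Execution 𝒮) : Finset (Finset F) :=
  tripleTiles A.P A.naming

/-- The tiles that attach each leftover symbol (other than the root) to the root. -/
def T₁ (A : Execution 𝒮) : Finset (Finset F) :=
  ((Finset.univ \ support (A.T₂ ∪ A.T₃)).erase A.root).image fun f => {f, A.root}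

/-- The set of tiles that the execution returns. -/
def output (A : Execution 𝒮) : Finset (Finset F) :=
  A.T₁ ∪ A.T₂ ∪ A.T₃

end Execution

end FeasibleTileset

/-! Let `n` be the number of symbols, `M` the matching and `P` the packing. The output has at most
`n - |M| - |P|` tiles (`card_output_le`), as a matched pair saves one tile and a packed triple saves
one.

For the lower bound, view a feasible tileset as a multigraph on the symbols. A component with `k`
symbols has at least `k - 1` tiles, and at least `k` if some scenario contains it, since only its
own tiles can serve it. The components with exactly `k - 1` tiles are therefore disjoint sets that
lie in no scenario. If `p` of them have two symbols and `q` have three, then `3n ≤ 4|𝒯'| + 2p + q`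
(`exists_disjoint_allowedSets`). Maximality of `M` and `P` gives `2p + q ≤ 3|M| + 3|P|`
(`card_pairs_triples_le`), and the ratio `4/3` follows.

The output is feasible because a scenario misses a symbol of every matched pair and every packed
triple, and leftover symbols have tiles of their own (`feasibleFor_output`). -/

namespace FeasibleTileset

/-! ### Components of a feasible tileset. -/

section LowerBound

variable {F ι : Type*} [Fintype F] [DecidableEq F] [Fintype ι]

/-- The graph on the symbols whose edges are the tiles of a family. -/
def tileGraph (t : ι → Finset F) : SimpleGraph F where
  Adj u v := u ≠ v ∧ ∃ i, t i = {u, v}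
  symm := ⟨fun u v ⟨h, i, hi⟩ => ⟨h.symm, i, by rw [hi, Finset.pair_comm]⟩⟩
  loopless := ⟨fun _ h => h.1 rfl⟩

/-- The symbols can be partitioned into parts that contain every tile they meet, and of which
each part with `k` symbols contains at least `k - 1` tiles. -/
theorem exists_component_partition (t : ι → Finset F) (ht : ∀ i, (t i).card = 2) :
    ∃ 𝒦 : Finset (Finset F),
      (∀ K ∈ 𝒦, ∀ K' ∈ 𝒦, K ≠ K' → Disjoint K K') ∧
      ∑ K ∈ 𝒦, K.card = Fintype.card F ∧
      ∀ K ∈ 𝒦, K.Nonempty ∧ K.card ≤ (Finset.univ.filter fun i => t i ⊆ K).card + 1 ∧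
        ∀ i, ∀ s ∈ t i, s ∈ K → t i ⊆ K := by
  classical
  set G := tileGraph t
  let supp : G.ConnectedComponent → Finset F := fun c =>
    Finset.univ.filter fun v => G.connectedComponentMk v = c
  have hmem : ∀ c v, v ∈ supp c ↔ G.connectedComponentMk v = c := fun c v => by simp [supp]
  have hdisj : ∀ c c', c ≠ c' → Disjoint (supp c) (supp c') := fun c c' h =>
    Finset.disjoint_left.2 fun v hv hv' => h (((hmem _ _).1 hv).symm.trans ((hmem _ _).1 hv'))
  have hne : ∀ c, (supp c).Nonempty := fun c => by
    induction c using SimpleGraph.ConnectedComponent.ind with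
    | h v => exact ⟨v, (hmem _ _).2 rfl⟩
  have hinj : Function.Injective supp := fun c c' h => by
    by_contra hc
    have := hdisj c c' hc
    rw [h, disjoint_self] at this
    exact (hne c').ne_empty this
  refine ⟨Finset.univ.image supp, ?_, ?_, ?_⟩
  · intro K hK K' hK' h
    obtain ⟨c, -, rfl⟩ := Finset.mem_image.1 hK
    obtain ⟨c', -, rfl⟩ := Finset.mem_image.1 hK'
    exact hdisj c c' fun hc => h (hc ▸ rfl)
  · rw [Finset.sum_image fun _ _ _ _ h => hinj h]
    exact (Finset.card_eq_sum_card_fiberwise (s := Finset.univ) (t := Finset.univ)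
      (f := G.connectedComponentMk) (by simp [Set.MapsTo])).symm
  · intro K hK
    obtain ⟨c, -, rfl⟩ := Finset.mem_image.1 hK
    refine ⟨hne c, ?_, ?_⟩
    · have h1 := c.connected_toSimpleGraph.card_vert_le_card_edgeSet_add_one
      have h2 : Nat.card c = (supp c).card := by
        rw [Nat.card_eq_fintype_card]
        exact Fintype.card_of_subtype _ fun x => hmem c x
      have h3 : Nat.card c.toSimpleGraph.edgeSet
          ≤ (Finset.univ.filter fun i => t i ⊆ supp c).card := by
        -- Copies of one tile give a single edge, so one copy is chosen per edge; the choice is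
        -- injective because a tile determines its edge.
        have key : ∀ e : c.toSimpleGraph.edgeSet, ∃ i : {i // t i ⊆ supp c},
            t i.1 = (Sym2.map Subtype.val e.1).toFinset := by
          rintro ⟨e, he⟩
          induction e using Sym2.ind with
          | h u v =>
            obtain ⟨-, i, hi⟩ : u.1 ≠ v.1 ∧ ∃ i, t i = {u.1, v.1} := he
            refine ⟨⟨i, ?_⟩, ?_⟩
            · rw [hi]
              intro x hx
              rw [hmem]
              rcases Finset.mem_insert.1 hx with rfl | hx
              · exact u.2
              · exact Finset.mem_singleton.1 hx ▸ v.2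
            · simp only [hi, Sym2.map_mk, Sym2.toFinset_mk_eq]
        choose g hg using key
        rw [← Fintype.card_subtype, ← Nat.card_eq_fintype_card]
        refine Nat.card_le_card_of_injective g fun e e' h => ?_
        have h' : (Sym2.map Subtype.val e.1).toFinset = (Sym2.map Subtype.val e'.1).toFinset := by
          rw [← hg e, ← hg e', h]
        refine Subtype.ext (Sym2.map.injective Subtype.val_injective (Sym2.ext fun x => ?_))
        rw [← Sym2.mem_toFinset, h', Sym2.mem_toFinset]
      lia
    · intro i s hs hsc x hx
      rw [hmem] at hsc ⊢
      by_cases hxs : x = s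
      · rw [hxs, hsc]
      rw [← hsc]
      refine SimpleGraph.ConnectedComponent.sound (SimpleGraph.Adj.reachable ⟨hxs, i, ?_⟩)
      refine (Finset.eq_of_subset_of_card_le ?_ ?_).symm
      · intro y hy
        rcases Finset.mem_insert.1 hy with rfl | hy
        · exact hx
        · exact Finset.mem_singleton.1 hy ▸ hs
      · rw [ht, Finset.card_pair hxs]

/-- Twice the number of parts with two symbols plus the number of parts with three symbols
compensates for what the tiles fall short of three quarters of the symbols. -/
theorem exists_disjoint_allowedSets {𝒮 : Finset (Finset F)}
    (h_occurs : ∀ f : F, ∃ S ∈ 𝒮, f ∈ S) {𝒯 : Multiset (Finset F)}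
    (h𝒯 : IsFeasibleTileset 𝒮 𝒯) :
    ∃ 𝒦 : Finset (Finset F),
      (∀ K ∈ 𝒦, ∀ K' ∈ 𝒦, K ≠ K' → Disjoint K K') ∧
      (∀ K ∈ 𝒦, ∀ S ∈ 𝒮, ¬ K ⊆ S) ∧
      3 * Fintype.card F ≤ 4 * Multiset.card 𝒯 +
        2 * (𝒦.filter fun K => K.card = 2).card + (𝒦.filter fun K => K.card = 3).card := by
  classical
  let t : 𝒯.ToType → Finset F := fun T => T.1
  have ht : ∀ T, (t T).card = 2 := fun T => h𝒯.1 _ Multiset.coe_mem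
  obtain ⟨𝒦, hdisj, hsum, hK⟩ := exists_component_partition t ht
  let e : Finset F → ℕ := fun K => (Finset.univ.filter fun i => t i ⊆ K).card
  have he : ∑ K ∈ 𝒦, e K ≤ Multiset.card 𝒯 := by
    rw [← Multiset.card_coe, ← Finset.card_univ, ← Finset.card_biUnion]
    · exact Finset.card_le_card (Finset.subset_univ _)
    · intro K hK1 K' hK2 hne
      refine Finset.disjoint_left.2 fun i hi hi' => ?_
      obtain ⟨x, hx⟩ : (t i).Nonempty := Finset.card_pos.1 (by rw [ht]; norm_num)
      exact Finset.disjoint_left.1 (hdisj K hK1 K' hK2 hne)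
        ((Finset.mem_filter.1 hi).2 hx) ((Finset.mem_filter.1 hi').2 hx)
  have hfull : ∀ K ∈ 𝒦, ∀ S ∈ 𝒮, K ⊆ S → K.card ≤ e K := by
    intro K hK1 S hS hKS
    obtain ⟨φ, hφ, hsurj⟩ := h𝒯.2 S hS
    calc K.card ≤ ((Finset.univ.filter fun i => t i ⊆ K).image φ).card := by
          refine Finset.card_le_card fun s hs => ?_
          obtain ⟨T, rfl⟩ := hsurj s (hKS hs)
          exact Finset.mem_image_of_mem _
            (Finset.mem_filter.2 ⟨Finset.mem_univ _, (hK K hK1).2.2 T _ (hφ T) hs⟩)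
      _ ≤ e K := Finset.card_image_le
  -- Keep the deficient parts, those with exactly `K.card - 1` tiles.
  refine ⟨𝒦.filter fun K => e K < K.card, ?_, ?_, ?_⟩
  · exact fun K h1 K' h2 => hdisj K (Finset.mem_filter.1 h1).1 K' (Finset.mem_filter.1 h2).1
  · intro K h S hS hKS
    have := hfull K (Finset.mem_filter.1 h).1 S hS hKS
    have := (Finset.mem_filter.1 h).2
    lia
  -- With `k - 1` tiles, `4(k - 1) ≥ 3k` fails only for `k ≤ 3`: the shortfall is 2 for `k = 2` and
  -- 1 for `k = 3`.
  · have hpart : ∀ K ∈ 𝒦, 3 * K.card ≤ 4 * e K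
        + 2 * (if e K < K.card ∧ K.card = 2 then 1 else 0)
        + (if e K < K.card ∧ K.card = 3 then 1 else 0) := by
      intro K hK1
      obtain ⟨⟨x, hx⟩, hcard, -⟩ := hK K hK1
      change K.card ≤ e K + 1 at hcard
      have hpos : 0 < K.card := Finset.card_pos.2 ⟨x, hx⟩
      -- A single symbol occurs in some scenario, so it is never deficient.
      have hone : K.card = 1 → K.card ≤ e K := fun h1 => by
        obtain ⟨S, hS, hxS⟩ := h_occurs x
        refine hfull K hK1 S hS fun y hy => ?_
        rwa [Finset.card_le_one.1 h1.le y hy x hx]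
      split_ifs <;> lia
    have := Finset.sum_le_sum hpart
    rw [Finset.sum_add_distrib, Finset.sum_add_distrib, ← Finset.mul_sum, ← Finset.mul_sum,
      ← Finset.mul_sum, hsum, ← Finset.card_filter, ← Finset.card_filter] at this
    rw [Finset.filter_filter, Finset.filter_filter]
    lia

end LowerBound

theorem exists_isMaximumMatching {F : Type*} (E : Finset (Finset F)) :
    ∃ M, IsMaximumMatching E M := by
  classical
  obtain ⟨M, hM, hmax⟩ := Finset.exists_max_image (E.powerset.filter (IsMatching E)) Finset.card
    ⟨∅, by simp [IsMatching]⟩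
  refine ⟨M, (Finset.mem_filter.1 hM).2, fun M' hM' => hmax M' ?_⟩
  exact Finset.mem_filter.2 ⟨Finset.mem_powerset.2 hM'.1, hM'⟩

/-! ### Matchings, packings and disjoint allowed sets. -/

section Counting

variable {F : Type*} [DecidableEq F]

theorem mem_support {𝒜 : Finset (Finset F)} {x : F} : x ∈ support 𝒜 ↔ ∃ A ∈ 𝒜, x ∈ A := by
  simp [support]

theorem subset_support {𝒜 : Finset (Finset F)} {A : Finset F} (hA : A ∈ 𝒜) : A ⊆ support 𝒜 :=
  fun _ hx => mem_support.2 ⟨A, hA, hx⟩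

theorem support_union (𝒜 ℬ : Finset (Finset F)) : support (𝒜 ∪ ℬ) = support 𝒜 ∪ support ℬ :=
  Finset.union_biUnion

theorem mem_allowedSets {𝒮 : Finset (Finset F)} {i : ℕ} {F' C : Finset F} :
    C ∈ allowedSets 𝒮 i F' ↔ C ⊆ F' ∧ C.card = i ∧ ∀ S ∈ 𝒮, ¬ C ⊆ S := by
  simp [allowedSets, and_assoc]

theorem card_support {𝒜 : Finset (Finset F)} {k : ℕ}
    (hdisj : ∀ A ∈ 𝒜, ∀ B ∈ 𝒜, A ≠ B → Disjoint A B) (hcard : ∀ A ∈ 𝒜, A.card = k) :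
    (support 𝒜).card = k * 𝒜.card := by
  rw [support, Finset.card_biUnion (t := id) hdisj, mul_comm]
  exact Finset.sum_const_nat hcard

/-- Disjoint sets that all meet `U` are at most as many as the elements of `U`. -/
theorem card_le_card_of_forall_not_disjoint {𝒜 : Finset (Finset F)} {U : Finset F}
    (hdisj : ∀ A ∈ 𝒜, ∀ B ∈ 𝒜, A ≠ B → Disjoint A B) (hU : ∀ A ∈ 𝒜, ¬ Disjoint A U) :
    𝒜.card ≤ U.card := by
  have h : ∀ A ∈ 𝒜, ∃ x, x ∈ A ∧ x ∈ U := fun A hA => Finset.not_disjoint_iff.1 (hU A hA)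
  rcases 𝒜.eq_empty_or_nonempty with rfl | ⟨A₀, hA₀⟩
  · simp
  have : Nonempty F := ⟨(h A₀ hA₀).choose⟩
  choose! g hg using h
  refine Finset.card_le_card_of_injOn g (fun A hA => (hg A hA).2) fun A hA B hB hAB => ?_
  by_contra hne
  exact Finset.disjoint_left.1 (hdisj A hA B hB hne) (hg A hA).1 (hAB ▸ (hg B hB).1)

theorem GreedyReach.subset {𝒞 P : Finset (Finset F)} (h : GreedyReach 𝒞 P) : P ⊆ 𝒞 := by
  induction h with
  | start => exact Finset.empty_subset _
  | take P C _ hC _ ih => exact Finset.insert_subset hC ih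

theorem GreedyReach.disjoint {𝒞 P : Finset (Finset F)} (h : GreedyReach 𝒞 P) :
    ∀ A ∈ P, ∀ B ∈ P, A ≠ B → Disjoint A B := by
  induction h with
  | start => simp
  | take P C _ _ hd ih =>
    intro A hA B hB hne
    rcases Finset.mem_insert.1 hA with rfl | hA' <;> rcases Finset.mem_insert.1 hB with rfl | hB'
    · exact absurd rfl hne
    · exact hd B hB'
    · exact (hd A hA').symm
    · exact ih A hA' B hB' hne

/-- A maximum matching meets every edge of the graph. -/
theorem IsMaximumMatching.not_disjoint_support {E M : Finset (Finset F)}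
    (h : IsMaximumMatching E M) {e : Finset F} (he : e ∈ E) (hne : e.Nonempty) :
    ¬ Disjoint e (support M) := by
  intro hd
  have hd' : ∀ e' ∈ M, Disjoint e e' := fun e' he' => hd.mono_right (subset_support he')
  have heM : e ∉ M := fun hM => hne.ne_empty (disjoint_self.1 (hd' e hM))
  have hle := h.2 (insert e M) ⟨Finset.insert_subset he h.1.1, fun A hA B hB hAB => ?_⟩
  · rw [Finset.card_insert_of_notMem heM] at hle
    lia
  · rcases Finset.mem_insert.1 hA with rfl | hA' <;> rcases Finset.mem_insert.1 hB with rfl | hB'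
    · exact absurd rfl hAB
    · exact hd' B hB'
    · exact (hd' A hA').symm
    · exact h.1.2 A hA' B hB' hAB

/-- A largest reachable packing cannot be extended. Candidates must be nonempty: an empty one is
disjoint from everything and would never be blocked. -/
theorem exists_isGreedyPacking (𝒞 : Finset (Finset F)) (hne : ∀ C ∈ 𝒞, C.Nonempty) :
    ∃ P, IsGreedyPacking 𝒞 P := by
  classical
  obtain ⟨P, hP, hmax⟩ := Finset.exists_max_image (𝒞.powerset.filter (GreedyReach 𝒞)) Finset.card
    ⟨∅, by simp [GreedyReach.start]⟩
  have hP := (Finset.mem_filter.1 hP).2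
  refine ⟨P, hP, fun C hC => ?_⟩
  by_contra! hd
  have hCP : C ∉ P := fun h => (hne C hC).ne_empty (disjoint_self.1 (hd C h))
  have hreach := GreedyReach.take P C hP hC hd
  have := hmax _ (Finset.mem_filter.2 ⟨Finset.mem_powerset.2 hreach.subset, hreach⟩)
  rw [Finset.card_insert_of_notMem hCP] at this
  lia

/-- Disjoint allowed sets are controlled by a maximum matching of allowed pairs and a greedy
packing of allowed triples outside the matching. -/
theorem card_pairs_triples_le [Fintype F] {𝒮 M P 𝒦 : Finset (Finset F)}
    (hM : IsMaximumMatching (allowedSets 𝒮 2 Finset.univ) M)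
    (hP : IsGreedyPacking (allowedSets 𝒮 3 (Finset.univ \ support M)) P)
    (hdisj : ∀ K ∈ 𝒦, ∀ K' ∈ 𝒦, K ≠ K' → Disjoint K K')
    (hallowed : ∀ K ∈ 𝒦, ∀ S ∈ 𝒮, ¬ K ⊆ S) :
    2 * (𝒦.filter fun K => K.card = 2).card + (𝒦.filter fun K => K.card = 3).card
      ≤ 3 * M.card + 3 * P.card := by
  classical
  have hpairs : (𝒦.filter fun K => K.card = 2).card ≤ M.card := by
    refine hM.2 _ ⟨fun K hK => ?_, fun K hK K' hK' => ?_⟩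
    · have hK := Finset.mem_filter.1 hK
      exact mem_allowedSets.2 ⟨Finset.subset_univ _, hK.2, hallowed K hK.1⟩
    · exact hdisj K (Finset.mem_filter.1 hK).1 K' (Finset.mem_filter.1 hK').1
  have hcardM := card_support hM.1.2 fun e he => (mem_allowedSets.1 (hM.1.1 he)).2.1
  have hcardP := card_support hP.1.disjoint fun C hC => (mem_allowedSets.1 (hP.1.subset hC)).2.1
  set 𝒜 := 𝒦.filter fun K => K.card = 3 ∧ ¬ Disjoint K (support M)
  set ℬ := 𝒦.filter fun K => K.card = 3 ∧ Disjoint K (support M)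
  have hsplit : (𝒦.filter fun K => K.card = 3).card ≤ 𝒜.card + ℬ.card := by
    refine (Finset.card_le_card fun K hK => ?_).trans (Finset.card_union_le 𝒜 ℬ)
    simp only [𝒜, ℬ, Finset.mem_union, Finset.mem_filter] at hK ⊢
    tauto
  -- Pairs and the triples in `𝒜` use distinct matched symbols, so `p + |𝒜| ≤ 2|M|`. Adding `p ≤
  -- |M|` and `|ℬ| ≤ 3|P|` gives the claim.
  have hmeetM : ((𝒦.filter fun K => K.card = 2) ∪ 𝒜).card ≤ (support M).card := by
    refine card_le_card_of_forall_not_disjoint (fun K hK K' hK' => hdisj K ?_ K' ?_)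
      fun K hK => ?_
    · rcases Finset.mem_union.1 hK with h | h <;> exact (Finset.mem_filter.1 h).1
    · rcases Finset.mem_union.1 hK' with h | h <;> exact (Finset.mem_filter.1 h).1
    · rcases Finset.mem_union.1 hK with h | h
      · have h := Finset.mem_filter.1 h
        exact hM.not_disjoint_support
          (mem_allowedSets.2 ⟨Finset.subset_univ _, h.2, hallowed K h.1⟩)
          (Finset.card_pos.1 (by rw [h.2]; norm_num))
      · exact (Finset.mem_filter.1 h).2.2
  rw [Finset.card_union_of_disjoint] at hmeetM
  swap
  · refine Finset.disjoint_left.2 fun K h h' => ?_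
    have h := (Finset.mem_filter.1 h).2
    have h' := (Finset.mem_filter.1 h').2.1
    lia
  have hmeetP : ℬ.card ≤ (support P).card := by
    refine card_le_card_of_forall_not_disjoint (fun K hK K' hK' =>
      hdisj K (Finset.mem_filter.1 hK).1 K' (Finset.mem_filter.1 hK').1) fun K hK hd => ?_
    obtain ⟨hK, h3, hdM⟩ := Finset.mem_filter.1 hK
    obtain ⟨D, hD, hKD⟩ := hP.2 K (mem_allowedSets.2 ⟨fun x hx => Finset.mem_sdiff.2
      ⟨Finset.mem_univ _, Finset.disjoint_left.1 hdM hx⟩, h3, hallowed K hK⟩)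
    exact hKD (hd.mono_right (subset_support hD))
  lia

end Counting

/-! ### Serving a scenario by distinct tiles. -/

section Tiles

variable {F : Type*} [DecidableEq F]

theorem mem_tripleTiles {P : Finset (Finset F)} {f : Finset F → Fin 3 → F} {T : Finset F} :
    T ∈ tripleTiles P f ↔ ∃ C ∈ P, T = {f C 0, f C 1} ∨ T = {f C 1, f C 2} := by
  simp [tripleTiles]

theorem support_tripleTiles {P : Finset (Finset F)} {f : Finset F → Fin 3 → F}
    (hf : ∀ C ∈ P, C = {f C 0, f C 1, f C 2}) : support (tripleTiles P f) = support P := by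
  ext x
  simp only [mem_support, mem_tripleTiles]
  constructor
  · rintro ⟨T, ⟨C, hC, rfl | rfl⟩, hx⟩ <;> refine ⟨C, hC, ?_⟩ <;> rw [hf C hC] <;>
      simp only [Finset.mem_insert, Finset.mem_singleton] at hx ⊢ <;> tauto
  · rintro ⟨C, hC, hx⟩
    rw [hf C hC] at hx
    simp only [Finset.mem_insert, Finset.mem_singleton] at hx
    rcases hx with hx | hx | hx
    · exact ⟨_, ⟨C, hC, Or.inl rfl⟩, by simp [hx]⟩
    · exact ⟨_, ⟨C, hC, Or.inl rfl⟩, by simp [hx]⟩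
    · exact ⟨_, ⟨C, hC, Or.inr rfl⟩, by simp [hx]⟩

theorem card_tripleTiles_le (P : Finset (Finset F)) (f : Finset F → Fin 3 → F) :
    (tripleTiles P f).card ≤ 2 * P.card := by
  rw [mul_comm]
  exact Finset.card_biUnion_le_card_mul _ _ _ fun C _ => Finset.card_le_two

/-- A set of tiles is feasible for `S` if the symbols of `S` lie on distinct tiles. -/
theorem feasibleFor_of_injOn {𝒜 : Finset (Finset F)} {S : Finset F}
    (hne : ∀ T ∈ 𝒜, T.Nonempty) (τ : F → Finset F) (hτ : ∀ s ∈ S, τ s ∈ 𝒜 ∧ s ∈ τ s)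
    (hinj : ∀ s ∈ S, ∀ s' ∈ S, τ s = τ s' → s = s') : FeasibleFor 𝒜.val S := by
  classical
  have key : ∀ T : 𝒜.val.ToType, ∃ x, x ∈ T.1 ∧ ∀ s ∈ S, τ s = T.1 → x = s := by
    -- A tile assigned to no symbol of `S` may choose either of its symbols.
    intro T
    by_cases h : ∃ s ∈ S, τ s = T.1
    · obtain ⟨s, hs, hsT⟩ := h
      exact ⟨s, hsT ▸ (hτ s hs).2, fun s' hs' h' => hinj s hs s' hs' (hsT.trans h'.symm)⟩
    · obtain ⟨x, hx⟩ := hne T.1 (Multiset.coe_mem (x := T))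
      exact ⟨x, hx, fun s hs hsT => absurd ⟨s, hs, hsT⟩ h⟩
  choose φ hφ hφS using key
  refine ⟨φ, hφ, fun s hs => ?_⟩
  have hpos : 0 < 𝒜.val.count (τ s) := Multiset.count_pos.2 (hτ s hs).1
  exact ⟨⟨τ s, ⟨0, hpos⟩⟩, hφS _ s hs rfl⟩

/-- The two tiles `{a, b}` and `{b, c}` serve every set that does not contain `a`, `b` and `c`. -/
theorem exists_injOn_tiles_of_triple {a b c : F} (hab : a ≠ b) (hac : a ≠ c) (hbc : b ≠ c)
    {S : Finset F} (hS : ¬ ({a, b, c} : Finset F) ⊆ S) :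
    ∃ τ : F → Finset F,
      (∀ s ∈ ({a, b, c} : Finset F), (τ s = {a, b} ∨ τ s = {b, c}) ∧ s ∈ τ s) ∧
      ∀ s ∈ ({a, b, c} : Finset F), ∀ s' ∈ ({a, b, c} : Finset F),
        s ∈ S → s' ∈ S → τ s = τ s' → s = s' := by
  have hne : ({a, b} : Finset F) ≠ {b, c} := fun h => by
    have : a ∈ ({b, c} : Finset F) := h ▸ Finset.mem_insert_self a {b}
    simp [hab, hac] at this
  have hS' : ¬ (a ∈ S ∧ b ∈ S ∧ c ∈ S) := fun h => hS (by
    simp [Finset.insert_subset_iff, h.1, h.2.1, h.2.2])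
  -- If `a ∈ S`, then `b` and `c` are not both in `S` and can share `{b, c}`; otherwise `a` and `b`
  -- can share `{a, b}`.
  by_cases ha : a ∈ S
  · refine ⟨fun s => if s = a then {a, b} else {b, c}, ?_, ?_⟩
    · simp [hab.symm, hac.symm]
    · simp [hab.symm, hac.symm, hne, hne.symm]
      tauto
  · refine ⟨fun s => if s = c then {b, c} else {a, b}, ?_, ?_⟩
    · simp [hac, hbc]
    · simp [hac, hbc, hne, hne.symm, ha]

end Tiles

/-! ### Executions: existence, feasibility and size of the output. -/

namespace Execution

variable {F : Type*} [DecidableEq F] [Fintype F] {𝒮 : Finset (Finset F)}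

theorem nonempty_execution [Nonempty F] (𝒮 : Finset (Finset F)) : Nonempty (Execution 𝒮) := by
  classical
  obtain ⟨M, hM⟩ := exists_isMaximumMatching (allowedSets 𝒮 2 (Finset.univ : Finset F))
  obtain ⟨P, hP⟩ := exists_isGreedyPacking (allowedSets 𝒮 3 (Finset.univ \ support M))
    fun C hC => Finset.card_pos.1 (by rw [(mem_allowedSets.1 hC).2.1]; norm_num)
  have hname : ∀ C : Finset F, ∃ f : Fin 3 → F, C ∈ P → C = {f 0, f 1, f 2} := by
    intro C
    by_cases hC : C ∈ P
    · obtain ⟨a, b, c, -, -, -, h⟩ :=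
        Finset.card_eq_three.1 (mem_allowedSets.1 (hP.1.subset hC)).2.1
      exact ⟨![a, b, c], fun _ => by simpa using h⟩
    · exact ⟨fun _ => Classical.arbitrary F, fun h => absurd h hC⟩
  choose f hf using hname
  obtain ⟨r, hr⟩ : ∃ r : F, M ∪ tripleTiles P f ≠ ∅ → r ∈ support (M ∪ tripleTiles P f) := by
    by_cases h : M ∪ tripleTiles P f = ∅
    · exact ⟨Classical.arbitrary F, fun h' => absurd h h'⟩
    · obtain ⟨T, hT⟩ := Finset.nonempty_iff_ne_empty.2 h
      have hTne : T.Nonempty := by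
        rcases Finset.mem_union.1 hT with hT | hT
        · exact Finset.card_pos.1 (by rw [(mem_allowedSets.1 (hM.1.1 hT)).2.1]; norm_num)
        · obtain ⟨C, -, rfl | rfl⟩ := mem_tripleTiles.1 hT <;> exact Finset.insert_nonempty _ _
      obtain ⟨x, hx⟩ := hTne
      exact ⟨x, fun _ => mem_support.2 ⟨T, hT, hx⟩⟩
  exact ⟨⟨M, hM, P, hP, f, hf, r, hr⟩⟩

theorem support_T₂_union_T₃ (A : Execution 𝒮) :
    support (A.T₂ ∪ A.T₃) = support A.T₂ ∪ support A.P := by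
  rw [support_union, T₃, support_tripleTiles A.naming_spec]

theorem card_of_mem_T₂ (A : Execution 𝒮) {e : Finset F} (he : e ∈ A.T₂) : e.card = 2 :=
  (mem_allowedSets.1 (A.maximumMatching.1.1 he)).2.1

theorem card_of_mem_P (A : Execution 𝒮) {C : Finset F} (hC : C ∈ A.P) : C.card = 3 :=
  (mem_allowedSets.1 (A.greedyPacking.1.subset hC)).2.1

theorem disjoint_support (A : Execution 𝒮) {C : Finset F} (hC : C ∈ A.P) :
    Disjoint C (support A.T₂) :=
  Finset.disjoint_left.2 fun _ hx =>
    (Finset.mem_sdiff.1 ((mem_allowedSets.1 (A.greedyPacking.1.subset hC)).1 hx)).2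

theorem naming_ne (A : Execution 𝒮) {C : Finset F} (hC : C ∈ A.P) :
    A.naming C 0 ≠ A.naming C 1 ∧ A.naming C 0 ≠ A.naming C 2 ∧
      A.naming C 1 ≠ A.naming C 2 := by
  have h := A.card_of_mem_P hC
  rw [A.naming_spec C hC] at h
  refine ⟨fun h' => ?_, fun h' => ?_, fun h' => ?_⟩
  · rw [h', Finset.insert_eq_of_mem (Finset.mem_insert_self _ _)] at h
    exact absurd h (Finset.card_le_two.trans_lt (by norm_num)).ne
  · rw [h', Finset.insert_eq_of_mem (by simp)] at h
    exact absurd h (Finset.card_le_two.trans_lt (by norm_num)).ne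
  · rw [h', Finset.pair_eq_singleton] at h
    exact absurd h (Finset.card_le_two.trans_lt (by norm_num)).ne

theorem isTileset_output (A : Execution 𝒮) : IsTileset A.output.val := by
  intro T hT
  rcases Finset.mem_union.1 (show T ∈ A.T₁ ∪ A.T₂ ∪ A.T₃ from hT) with hT | hT
  · rcases Finset.mem_union.1 hT with hT | hT
    · obtain ⟨f, hf, rfl⟩ := Finset.mem_image.1 hT
      exact Finset.card_pair (Finset.mem_erase.1 hf).1
    · exact A.card_of_mem_T₂ hT
  · obtain ⟨C, hC, rfl | rfl⟩ := mem_tripleTiles.1 hT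
    · exact Finset.card_pair (A.naming_ne hC).1
    · exact Finset.card_pair (A.naming_ne hC).2.2

/-- Each symbol of a scenario that is covered before the last step gets its own tile. -/
theorem exists_tiles_of_block (A : Execution 𝒮) {S : Finset F} (hS : S ∈ 𝒮) {C : Finset F}
    (hC : C ∈ A.T₂ ∪ A.P) :
    ∃ τ : F → Finset F, (∀ s ∈ C, τ s ∈ A.T₂ ∪ A.T₃ ∧ s ∈ τ s ∧ τ s ⊆ C) ∧
      ∀ s ∈ C, ∀ s' ∈ C, s ∈ S → s' ∈ S → τ s = τ s' → s = s' := by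
  rcases Finset.mem_union.1 hC with hC | hC
  · refine ⟨fun _ => C, fun s hs => ⟨Finset.mem_union_left _ hC, hs, subset_rfl⟩, ?_⟩
    -- Two distinct symbols of the pair in `S` would put the whole pair inside `S`.
    intro s hs s' hs' hsS hsS' _
    by_contra hne
    refine (mem_allowedSets.1 (A.maximumMatching.1.1 hC)).2.2 S hS ?_
    have : ({s, s'} : Finset F) = C := Finset.eq_of_subset_of_card_le
      (Finset.insert_subset hs (Finset.singleton_subset_iff.2 hs'))
      (by rw [Finset.card_pair hne, A.card_of_mem_T₂ hC])
    rw [← this]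
    exact Finset.insert_subset hsS (Finset.singleton_subset_iff.2 hsS')
  · have hname := A.naming_spec C hC
    have hnot := (mem_allowedSets.1 (A.greedyPacking.1.subset hC)).2.2 S hS
    obtain ⟨h01, h02, h12⟩ := A.naming_ne hC
    obtain ⟨τ, hτ, hinj⟩ := exists_injOn_tiles_of_triple h01 h02 h12 (hname ▸ hnot)
    refine ⟨τ, fun s hs => ?_, fun s hs s' hs' => hinj s (hname ▸ hs) s' (hname ▸ hs')⟩
    obtain ⟨h, hmem⟩ := hτ s (hname ▸ hs)
    refine ⟨Finset.mem_union_right _ (mem_tripleTiles.2 ⟨C, hC, h⟩), hmem, ?_⟩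
    rw [hname]
    rcases h with h | h <;> rw [h]
    · intro x
      simp only [Finset.mem_insert, Finset.mem_singleton]
      tauto
    · exact Finset.subset_insert _ _

theorem block_disjoint (A : Execution 𝒮) :
    ∀ C ∈ A.T₂ ∪ A.P, ∀ D ∈ A.T₂ ∪ A.P, C ≠ D → Disjoint C D := by
  intro C hC D hD hne
  rcases Finset.mem_union.1 hC with hC | hC <;> rcases Finset.mem_union.1 hD with hD | hD
  · exact A.maximumMatching.1.2 C hC D hD hne
  · exact ((A.disjoint_support hD).mono_right (subset_support hC)).symm
  · exact (A.disjoint_support hC).mono_right (subset_support hD)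
  · exact A.greedyPacking.1.disjoint C hC D hD hne

/-- Covered symbols use the tiles of their block and leftover symbols their star tiles. An uncovered
root has no star tile of its own, but a symbol `g ∉ S` then has one to spare; this is where `S ≠ F`
enters. -/
theorem feasibleFor_output (A : Execution 𝒮) {S : Finset F} (hS : S ∈ 𝒮)
    (huniv : S ≠ Finset.univ) : FeasibleFor A.output.val S := by
  classical
  obtain ⟨g, hg⟩ : ∃ g, g ∉ S := by
    by_contra! h
    exact huniv (Finset.eq_univ_of_forall h)
  set U := support (A.T₂ ∪ A.T₃) with hU
  have hblock : ∀ x ∈ U, ∃ C ∈ A.T₂ ∪ A.P, x ∈ C := fun x hx => by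
    rw [hU, support_T₂_union_T₃, ← support_union] at hx
    exact mem_support.1 hx
  choose! B hB hxB using hblock
  have hτ := fun C (hC : C ∈ A.T₂ ∪ A.P) => A.exists_tiles_of_block hS hC
  choose! τ hτ hinj using hτ
  have hstar : ∀ x, x ∉ U → x ≠ A.root → {x, A.root} ∈ A.T₁ := fun x hx hne =>
    Finset.mem_image_of_mem _ (Finset.mem_erase.2
      ⟨hne, Finset.mem_sdiff.2 ⟨Finset.mem_univ _, hx⟩⟩)
  -- An uncovered root means that there was no pair or triple at all.
  have hroot : A.root ∉ U → ∀ x, x ∉ U := fun h x hx => by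
    obtain ⟨T, hT, -⟩ := mem_support.1 hx
    exact h (A.root_spec (Finset.ne_empty_of_mem hT))
  have hUsub : ∀ s ∈ U, τ (B s) s ⊆ U := fun s hs =>
    subset_support (hτ _ (hB s hs) s (hxB s hs)).1
  let leaf : F → F := fun s => if s = A.root then g else s
  have hleaf : ∀ s ∈ S, s ∉ U → leaf s ∉ U ∧ leaf s ≠ A.root := fun s hs hsU => by
    by_cases h : s = A.root
    · simp only [leaf, h, if_true]
      exact ⟨hroot (h ▸ hsU) g, fun h' => hg (by rw [h', ← h]; exact hs)⟩
    · simp only [leaf, h, if_false]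
      exact ⟨hsU, h⟩
  refine feasibleFor_of_injOn (𝒜 := A.output)
    (fun T hT => Finset.card_pos.1 (by rw [A.isTileset_output T hT]; norm_num))
    (fun s => if s ∈ U then τ (B s) s else {leaf s, A.root}) (fun s hs => ?_) ?_
  · by_cases hsU : s ∈ U
    · simp only [hsU, if_true]
      obtain ⟨h, h', -⟩ := hτ _ (hB s hsU) s (hxB s hsU)
      refine ⟨?_, h'⟩
      rw [output, Finset.union_assoc]
      exact Finset.mem_union_right _ h
    · simp only [hsU, if_false]
      obtain ⟨h, h'⟩ := hleaf s hs hsU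
      refine ⟨?_, ?_⟩
      · rw [output, Finset.union_assoc]
        exact Finset.mem_union_left _ (hstar _ h h')
      · by_cases hr : s = A.root <;> simp [leaf, hr]
  · intro s hs s' hs' heq
    by_cases hsU : s ∈ U <;> by_cases hsU' : s' ∈ U <;>
      simp only [hsU, hsU', if_true, if_false] at heq
    · obtain ⟨-, hm, hsub⟩ := hτ _ (hB s hsU) s (hxB s hsU)
      obtain ⟨-, -, hsub'⟩ := hτ _ (hB s' hsU') s' (hxB s' hsU')
      -- A tile shared by two blocks would contain a symbol common to both.
      have hBB : B s = B s' := by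
        by_contra hne
        exact Finset.disjoint_left.1 (A.block_disjoint _ (hB s hsU) _ (hB s' hsU') hne)
          (hsub hm) (hsub' (heq ▸ hm))
      refine hinj _ (hB s hsU) s (hxB s hsU) s' (hBB ▸ hxB s' hsU') hs hs' ?_
      rw [heq, hBB]
    · exact absurd (hUsub s hsU (heq ▸ Finset.mem_insert_self _ _)) (hleaf s' hs' hsU').1
    · exact absurd (hUsub s' hsU' (heq ▸ Finset.mem_insert_self _ _)) (hleaf s hs hsU).1
    · have h1 : leaf s ∈ ({leaf s', A.root} : Finset F) := heq ▸ Finset.mem_insert_self _ _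
      have h2 : leaf s = leaf s' := by
        rcases Finset.mem_insert.1 h1 with h | h
        · exact h
        · exact absurd (Finset.mem_singleton.1 h) (hleaf s hs hsU).2
      by_cases hr : s = A.root <;> by_cases hr' : s' = A.root
      · rw [hr, hr']
      · simp only [leaf, hr, hr', if_true, if_false] at h2
        exact absurd (h2 ▸ hs') hg
      · simp only [leaf, hr, hr', if_true, if_false] at h2
        exact absurd (h2 ▸ hs) hg
      · simpa only [leaf, hr, hr', if_false] using h2

theorem card_output_le (A : Execution 𝒮) :
    A.output.card + A.T₂.card + A.P.card ≤ Fintype.card F := by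
  have h₂ := card_support A.maximumMatching.1.2 fun e he => A.card_of_mem_T₂ he
  have h₃ := card_support A.greedyPacking.1.disjoint fun C hC => A.card_of_mem_P hC
  have hU : (support (A.T₂ ∪ A.T₃)).card = 2 * A.T₂.card + 3 * A.P.card := by
    rw [support_T₂_union_T₃, Finset.card_union_of_disjoint, h₂, h₃]
    refine (Finset.disjoint_left.2 fun x hx => ?_ : Disjoint (support A.P) (support A.T₂)).symm
    obtain ⟨C, hC, hxC⟩ := mem_support.1 hx
    exact Finset.disjoint_left.1 (A.disjoint_support hC) hxC
  -- The possible saving of one tile at an uncovered root is not needed.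
  have h₁ : A.T₁.card ≤ (Finset.univ \ support (A.T₂ ∪ A.T₃)).card :=
    Finset.card_image_le.trans (Finset.card_le_card (Finset.erase_subset _ _))
  have hle := Finset.card_le_univ (support (A.T₂ ∪ A.T₃))
  rw [Finset.card_sdiff_of_subset (Finset.subset_univ _), Finset.card_univ] at h₁
  have hT₃ : A.T₃.card ≤ 2 * A.P.card := card_tripleTiles_le _ _
  have hu₁ := Finset.card_union_le (A.T₁ ∪ A.T₂) A.T₃
  have hu₂ := Finset.card_union_le A.T₁ A.T₂
  rw [output]
  lia

end Execution

end FeasibleTileset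

/-- For a nonempty finite set `F` of symbols and a family `𝒮` of scenarios that does not contain
`F` and in which every symbol occurs, Algorithm A can be executed, and every execution of it
returns a feasible tileset with at most `4/3` times the minimum number of tiles. -/
theorem mainTheorem5 {F : Type*} [Fintype F] [DecidableEq F] [Nonempty F]
    (𝒮 : Finset (Finset F))
    (h_univ : (Finset.univ : Finset F) ∉ 𝒮)
    (h_occurs : ∀ f : F, ∃ S ∈ 𝒮, f ∈ S) :
    Nonempty (FeasibleTileset.Execution 𝒮) ∧
      ∀ A : FeasibleTileset.Execution 𝒮,
        FeasibleTileset.IsApproximation (4 / 3) 𝒮 A.output.val := by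
  refine ⟨FeasibleTileset.Execution.nonempty_execution 𝒮, fun A => ⟨⟨A.isTileset_output,
    fun S hS => A.feasibleFor_output hS fun h => h_univ (h ▸ hS)⟩, fun 𝒯' h𝒯' => ?_⟩⟩
  obtain ⟨𝒦, hdisj, hallowed, hle⟩ :=
    FeasibleTileset.exists_disjoint_allowedSets h_occurs h𝒯'
  have hK := FeasibleTileset.card_pairs_triples_le A.maximumMatching A.greedyPacking hdisj hallowed
  have hout := A.card_output_le
  have h : 3 * A.output.card ≤ 4 * Multiset.card 𝒯' := by lia
  have hq : (3 : ℚ) * A.output.card ≤ 4 * Multiset.card 𝒯' := by exact_mod_cast h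
  rw [Finset.card_val]
  linarith
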